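/- Let $n\ge 1$, let $m_0,m_1,\dots,m_n\ge 1$ be integers, and consider the ReLU feed-forward network $y(x;\theta)=W^n f^{n-1}+b^n$, $f^\ell=\max\{0,\,W^\ell f^{\ell-1}+b^\ell\}$ (entrywise) for $1\le\ell\le n-1$, $f^0=x\in\mathbb R^{m_0}$, with $W^\ell\in\mathbb R^{m_\ell\times m_{\ell-1}}$, $b^\ell\in\mathbb R^{m_\ell}$. The parameters are initialized, and then re-initialized once, as follows (LPS initialization). First, all entries of all $W^\ell,b^\ell$ are drawn independently, those of layer $\ell$ from $\mathcal N(0,v_\ell)$, where $v_\ell=\frac{2}{m_\ell(m_{\ell-1}+1)}$ for $\ell\le n-1$ and $v_n=\frac1{m_{n-1}+1}$. Then a random set of layers is chosen, independently of all other randomness, such that for every $\ell\in\{1,\dots,n\}$ layer $\ell$ is chosen with probability $p_\ell=\frac{2^\ell}{2^{n+1}-1}$ (the joint law of these choices is otherwise arbitrary). In every chosen layer $\ell$, each negative entry of $W^\ell$ and $b^\ell$ is, independently and with probability $\frac12$, replaced by a fresh independent sample of $\mathcal N(0,v_\ell)$; all other entries are kept. Let $\theta$ be the resulting parameters. The network is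 called *born dead in $\Omega$* if $x\mapsto y(x;\theta)$ is constant on $\Omega$. Theorem (one re-initialization). There is a constant $\delta$ with $0<\delta\le\frac12$, independent of $n$, of $m_0,\dots,m_n$, of $\ell$, of $c$ and of the joint law of the choices of layers, such that for every $c>0$, with $\Omega=[-c,c]^{m_0}$, $$P\bigl(y(x;\theta)\text{ is born dead in }\Omega\bigr)\le 1-\prod_{\ell=1}^{n-1}\Bigl(1-2^{-m_\ell}\bigl((1-p_\ell)+p_\ell(1-\tfrac{\delta}{2})^{m_\ell}\bigr)\Bigr).$$ -/

import Mathlib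

open MeasureTheory ProbabilityTheory

namespace LPS

/-- The parameters of one layer with `a` inputs and `b` neurons. The entry at `s`, `some k` is the
weight `W s k`; the entry at `s`, `none` is the bias of the neuron `s`. -/
abbrev LayerParams (a b : ℕ) : Type := Fin b → Option (Fin a) → ℝ

/-- The parameters `W¹, b¹, …, Wⁿ, bⁿ` of a network with widths `m 0, m 1, …, m n`.
The parameters of layer `ℓ + 1` stand at the index `ℓ : Fin n`. -/
abbrev Params (n : ℕ) (m : ℕ → ℕ) : Type := (ℓ : Fin n) → LayerParams (m ℓ) (m (ℓ + 1))

/-- The affine map `z ↦ W z + b` of one layer. -/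
def affine {a b : ℕ} (L : LayerParams a b) (z : Fin a → ℝ) : Fin b → ℝ :=
  fun s => ∑ k, L s (some k) * z k + L s none

/-- The rectified linear unit, entry by entry. -/
def relu {a : ℕ} (z : Fin a → ℝ) : Fin a → ℝ := fun k => max 0 (z k)

/-- The values before activation, `f¹ = W¹ x + b¹` and `f^(ℓ+1) = W^(ℓ+1) σ(f^ℓ) + b^(ℓ+1)`
(with `f⁰ = x`). -/
def preact {n : ℕ} {m : ℕ → ℕ} (θ : Params n m) (x : Fin (m 0) → ℝ) :
    (ℓ : ℕ) → ℓ ≤ n → Fin (m ℓ) → ℝ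
  | 0, _ => x
  | 1, h => affine (θ ⟨0, h⟩) x
  | ℓ + 2, h => affine (θ ⟨ℓ + 1, h⟩) (relu (preact θ x (ℓ + 1) (Nat.le_of_succ_le h)))

/-- The output `y(x; θ)`: the last layer is affine, all earlier ones are activated. -/
def network {n : ℕ} {m : ℕ → ℕ} (θ : Params n m) (x : Fin (m 0) → ℝ) : Fin (m n) → ℝ :=
  preact θ x n le_rfl

/-- The cube `[-c, c]^d`. -/
def cube (d : ℕ) (c : ℝ) : Set (Fin d → ℝ) := {x | ∀ i, x i ∈ Set.Icc (-c) c}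

/-- A network (at initialization) is born dead in `D` if it is a constant function on `D`. -/
def BornDead {n : ℕ} {m : ℕ → ℕ} (θ : Params n m) (D : Set (Fin (m 0) → ℝ)) : Prop :=
  ∃ y₀ : Fin (m n) → ℝ, ∀ x ∈ D, network θ x = y₀

/-- The variance of the weights and biases of layer `ℓ` (`1 ≤ ℓ ≤ n`). -/
noncomputable def variance (n : ℕ) (m : ℕ → ℕ) (ℓ : ℕ) : NNReal :=
  if ℓ = n then 1 / ((m (ℓ - 1) : NNReal) + 1)
  else 2 / ((m ℓ : NNReal) * ((m (ℓ - 1) : NNReal) + 1))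

/-- The probability `p_ℓ` that layer `ℓ` is chosen for re-initialization. -/
noncomputable def layerProb (n ℓ : ℕ) : ℝ := 2 ^ ℓ / (2 ^ (n + 1) - 1)

/-- The randomness behind all parameters: for each one its first value, a coin, and a fresh value
that may replace the first one. -/
abbrev Draws (n : ℕ) (m : ℕ → ℕ) : Type :=
  (ℓ : Fin n) → Fin (m (ℓ + 1)) → Option (Fin (m ℓ)) → ℝ × Bool × ℝ

/-- The law of the randomness behind one parameter: two values from `N(0, v)` and a fair coin,
independent of each other. -/
noncomputable def entryMeasure (v : NNReal) : Measure (ℝ × Bool × ℝ) :=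
  (gaussianReal 0 v).prod ((PMF.uniformOfFintype Bool).toMeasure.prod (gaussianReal 0 v))

instance (v : NNReal) : IsProbabilityMeasure (entryMeasure v) := by
  unfold entryMeasure; infer_instance

/-- The draws for different parameters are independent. -/
noncomputable def drawMeasure (n : ℕ) (m : ℕ → ℕ) : Measure (Draws n m) :=
  Measure.pi fun ℓ : Fin n => Measure.pi fun _ => Measure.pi fun _ =>
    entryMeasure (variance n m (ℓ + 1))

instance (n : ℕ) (m : ℕ → ℕ) : IsProbabilityMeasure (drawMeasure n m) := by
  unfold drawMeasure; infer_instance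

/-- The parameters after one re-initialization. `r ℓ` tells whether layer `ℓ + 1` is chosen;
in a chosen layer, every negative parameter whose coin shows `true` is replaced by its fresh
value, and nothing else changes. -/
noncomputable def reinit {n : ℕ} {m : ℕ → ℕ} (r : Fin n → Bool) (ω : Draws n m) : Params n m :=
  fun ℓ s k =>
    if r ℓ = true ∧ (ω ℓ s k).1 < 0 ∧ (ω ℓ s k).2.1 = true then (ω ℓ s k).2.2 else (ω ℓ s k).1

/-- The law of the whole experiment when the choice of layers has the law `κ`: the choice of
layers is independent of the draws. -/
noncomputable def lpsMeasure (n : ℕ) (m : ℕ → ℕ) (κ : Measure (Fin n → Bool)) :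
    Measure ((Fin n → Bool) × Draws n m) :=
  κ.prod (drawMeasure n m)

instance (n : ℕ) (m : ℕ → ℕ) (κ : Measure (Fin n → Bool)) [IsProbabilityMeasure κ] :
    IsProbabilityMeasure (lpsMeasure n m κ) := by
  unfold lpsMeasure; infer_instance

end LPS

/-! Condition on the chosen layers. In a chosen layer a parameter is negative with probability 3/8,
independently of its absolute value. At the point `0` every layer has a nonnegative input, so a
neuron is inactive there with probability at most 3/8, or 1/2 in an unchosen layer
(`pi_weightedSum_nonpos_le`). The first bound is Katona's circle argument: couple the signs to
rotations of an arc of length three on a circle of eight.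

If the input of a layer varies over the cube and some neuron is active at `0`, its output almost
surely varies too, because distinct inputs almost surely have distinct affine images. Multiplying
over hidden layers bounds the conditional probability of a dead network (`bornDead_real_le`).

The choices of layers may be dependent, so the conditional product cannot be averaged factor by
factor. It is bounded below by a function linear in the choice indicators, whose mean depends only
on the `p_ℓ` (`prod_mixture_le_average`). The loss is absorbed by weakening the rate 3/4 to 7/8,
that is, by taking `δ = 1/4`; this needs the `p_ℓ` to sum to at most 1. -/

namespace LPS

/-! ### Resampling one coordinate of a product measure -/

section Update

variable {ι : Type*} [Fintype ι] [DecidableEq ι] {α : ι → Type*} [∀ i, MeasurableSpace (α i)]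

omit [Fintype ι] in
theorem measurable_update_prod (i : ι) :
    Measurable fun p : (∀ j, α j) × α i => Function.update p.1 i p.2 := by
  refine measurable_pi_lambda _ fun j => ?_
  by_cases h : j = i
  · subst h; simpa using measurable_snd
  · simpa [Function.update_of_ne h, Function.comp_def] using
      (measurable_pi_apply j).comp measurable_fst

/-- Redrawing one coordinate independently does not change a product measure. -/
theorem measurePreserving_update_prod (μ : ∀ i, Measure (α i)) [∀ i, IsProbabilityMeasure (μ i)]
    (i : ι) :
    MeasurePreserving (fun p : (∀ j, α j) × α i => Function.update p.1 i p.2)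
      ((Measure.pi μ).prod (μ i)) (Measure.pi μ) := by
  refine ⟨measurable_update_prod i, (Measure.pi_eq fun s hs => ?_).symm⟩
  rw [Measure.map_apply (measurable_update_prod i) (MeasurableSet.univ_pi hs)]
  have h : (fun p : (∀ j, α j) × α i => Function.update p.1 i p.2) ⁻¹' Set.univ.pi s =
      (Set.univ.pi (Function.update s i Set.univ)) ×ˢ s i := by
    ext p
    simp only [Set.mem_preimage, Set.mem_univ_pi, Set.mem_prod]
    constructor
    · intro h
      refine ⟨fun j => ?_, by simpa using h i⟩
      by_cases hj : j = i
      · subst hj; simp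
      · simpa [Function.update_of_ne hj] using h j
    · rintro ⟨h1, h2⟩ j
      by_cases hj : j = i
      · subst hj; simpa using h2
      · simpa [Function.update_of_ne hj] using h1 j
  rw [h, Measure.prod_prod, Measure.pi_pi, ← Finset.prod_erase_mul _ _ (Finset.mem_univ i),
    ← Finset.prod_erase_mul _ (fun j => μ j (s j)) (Finset.mem_univ i)]
  congr 1
  simp only [Function.update_self, measure_univ, mul_one]
  refine Finset.prod_congr rfl fun j hj => ?_
  rw [Function.update_of_ne (Finset.ne_of_mem_erase hj)]

theorem pi_apply_eq_lintegral_update (μ : ∀ i, Measure (α i)) [∀ i, IsProbabilityMeasure (μ i)]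
    (i : ι) {S : Set (∀ j, α j)} (hS : MeasurableSet S) :
    Measure.pi μ S =
      ∫⁻ x, μ i {y | Function.update x i y ∈ S} ∂Measure.pi μ := by
  rw [← (measurePreserving_update_prod μ i).measure_preimage hS.nullMeasurableSet,
    Measure.prod_apply (measurable_update_prod i hS)]
  rfl

end Update

/-! ### Linear forms in independent variables -/

section Hyperplane

variable {ι : Type*} [Fintype ι]

theorem measurable_weightedSum (a : ι → ℝ) : Measurable fun w : ι → ℝ => ∑ i, a i * w i :=
  Finset.measurable_sum _ fun i _ => (measurable_pi_apply i).const_mul _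

/-- With the other coordinates fixed, the equation has at most one solution in coordinate `i`, and
`ν` has no atoms. -/
theorem pi_hyperplane_eq_zero (ν : Measure ℝ) [IsProbabilityMeasure ν] [NullSingletonClass ν]
    {a : ι → ℝ} {i : ι} (ha : a i ≠ 0) :
    Measure.pi (fun _ : ι => ν) {w | ∑ j, a j * w j = 0} = 0 := by
  classical
  rw [pi_apply_eq_lintegral_update (fun _ : ι => ν) i
    (measurableSet_eq_fun (measurable_weightedSum a) measurable_const)]
  refine (lintegral_congr fun x => ?_).trans lintegral_zero
  refine Set.Subsingleton.measure_zero (fun y hy y' hy' => ?_) ν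
  simp only [Set.mem_ofPred_eq] at hy hy'
  rw [← Finset.add_sum_erase _ _ (Finset.mem_univ i)] at hy hy'
  have h : ∀ t : ℝ, ∑ j ∈ Finset.univ.erase i, a j * Function.update x i t j =
      ∑ j ∈ Finset.univ.erase i, a j * x j := fun t =>
    Finset.sum_congr rfl fun j hj => by rw [Function.update_of_ne (Finset.ne_of_mem_erase hj)]
  rw [h, Function.update_self] at hy hy'
  exact mul_left_cancel₀ ha (by linarith)

/-- A weighted sum of independent symmetric variables is nonpositive with probability one half. -/
theorem pi_weightedSum_nonpos_le_half (ν : Measure ℝ) [IsProbabilityMeasure ν] [NullSingletonClass ν]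
    (hν : ν.map (fun x => -x) = ν) {a : ι → ℝ} {i : ι} (ha : a i ≠ 0) :
    (Measure.pi fun _ : ι => ν).real {w | ∑ j, a j * w j ≤ 0} ≤ 1 / 2 := by
  set μ := Measure.pi fun _ : ι => ν
  have hS : MeasurableSet {w : ι → ℝ | ∑ j, a j * w j ≤ 0} :=
    measurableSet_le (measurable_weightedSum a) measurable_const
  have hneg : MeasurePreserving (fun (w : ι → ℝ) j => -w j) μ μ :=
    measurePreserving_pi _ _ fun _ => ⟨measurable_neg, hν⟩
  have h1 : μ.real {w | ∑ j, a j * w j ≤ 0} = μ.real {w | 0 ≤ ∑ j, a j * w j} := by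
    rw [measureReal_def, ← hneg.measure_preimage hS.nullMeasurableSet]
    simp [measureReal_def, Set.preimage]
  have h2 : μ.real {w | 0 ≤ ∑ j, a j * w j} ≤ μ.real {w | ∑ j, a j * w j ≤ 0}ᶜ := by
    have hsub : {w : ι → ℝ | 0 ≤ ∑ j, a j * w j} ⊆
        {w | ∑ j, a j * w j ≤ 0}ᶜ ∪ {w | ∑ j, a j * w j = 0} := by
      intro w hw
      rcases (show 0 ≤ ∑ j, a j * w j from hw).eq_or_lt with h | h
      · exact Or.inr h.symm
      · exact Or.inl (not_le.2 h)
    refine (measureReal_mono hsub).trans ((measureReal_union_le _ _).trans ?_)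
    rw [(measureReal_eq_zero_iff).2 (pi_hyperplane_eq_zero ν ha), add_zero]
  rw [probReal_compl_eq_one_sub hS] at h2
  linarith

end Hyperplane
end LPS

/-! ### The law of a single parameter -/

namespace LPS

/-- The final value of a parameter whose draws are `p`, in a layer that is chosen iff `b`. -/
noncomputable def redraw (b : Bool) (p : ℝ × Bool × ℝ) : ℝ :=
  if b = true ∧ p.1 < 0 ∧ p.2.1 = true then p.2.2 else p.1

theorem measurable_redraw (b : Bool) : Measurable (redraw b) := by
  unfold redraw
  refine Measurable.ite ?_ (by fun_prop) measurable_fst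
  refine (MeasurableSet.const _).inter (MeasurableSet.inter ?_ ?_)
  · exact measurableSet_lt measurable_fst measurable_const
  · exact (measurable_fst.comp measurable_snd) (measurableSet_singleton true)

/-- The law of a single parameter in a layer that is chosen iff `b`. -/
noncomputable def entryLaw (v : NNReal) (b : Bool) : Measure ℝ := (entryMeasure v).map (redraw b)

instance (v : NNReal) (b : Bool) : IsProbabilityMeasure (entryLaw v b) :=
  Measure.isProbabilityMeasure_map (measurable_redraw b).aemeasurable

theorem entryLaw_false (v : NNReal) : entryLaw v false = gaussianReal 0 v := by
  have h : redraw false = Prod.fst := by ext p; simp [redraw]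
  rw [entryLaw, h, entryMeasure, Measure.map_fst_prod]
  simp

section Gaussian

variable {v : NNReal}

theorem gaussianReal_neg_preimage {B : Set ℝ} (hB : MeasurableSet B) :
    (gaussianReal 0 v).real {x | -x ∈ B} = (gaussianReal 0 v).real B := by
  have h : (gaussianReal 0 v).map (fun x => -x) = gaussianReal 0 v := by
    rw [gaussianReal_map_neg, neg_zero]
  conv_rhs => rw [← h, map_measureReal_apply measurable_neg hB]
  rfl

theorem gaussianReal_inter_Ioi (hv : v ≠ 0) (B : Set ℝ) :
    (gaussianReal 0 v).real (B ∩ Set.Ioi 0) = (gaussianReal 0 v).real (B ∩ Set.Ici 0) := by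
  have := nullSingletonClass_gaussianReal (μ := 0) hv
  exact measureReal_congr ((Filter.EventuallyEq.refl _ _).inter Ioi_ae_eq_Ici)

theorem gaussianReal_eq_add {B : Set ℝ} :
    (gaussianReal 0 v).real B =
      (gaussianReal 0 v).real (B ∩ Set.Ici 0) + (gaussianReal 0 v).real (B ∩ Set.Iio 0) := by
  rw [← measureReal_inter_add_sdiff (s := B) (t := Set.Ici 0) measurableSet_Ici, Set.sdiff_eq,
    Set.compl_Ici]

theorem gaussianReal_Iio_zero (hv : v ≠ 0) : (gaussianReal 0 v).real (Set.Iio 0) = 1 / 2 := by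
  have h1 := gaussianReal_eq_add (v := v) (B := Set.univ)
  have h2 := gaussianReal_neg_preimage (v := v) (B := Set.Ioi 0) measurableSet_Ioi
  have h3 := gaussianReal_inter_Ioi hv Set.univ
  have h4 : {x : ℝ | -x ∈ Set.Ioi 0} = Set.Iio 0 := by ext; simp
  simp only [Set.univ_inter, probReal_univ] at h1 h3
  rw [h4] at h2
  linarith

theorem gaussianReal_abs_mem (hv : v ≠ 0) {B : Set ℝ} (hB : MeasurableSet B) :
    (gaussianReal 0 v).real {x | |x| ∈ B} = 2 * (gaussianReal 0 v).real (B ∩ Set.Ici 0) := by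
  have h1 : {x : ℝ | |x| ∈ B} ∩ Set.Ici 0 = B ∩ Set.Ici 0 := by
    ext x
    simp only [Set.mem_inter_iff, Set.mem_ofPred_eq, Set.mem_Ici, and_congr_left_iff]
    intro hx; rw [abs_of_nonneg hx]
  have h2 : {x : ℝ | |x| ∈ B} ∩ Set.Iio 0 = {x | -x ∈ B ∩ Set.Ioi 0} := by
    ext x
    simp only [Set.mem_inter_iff, Set.mem_ofPred_eq, Set.mem_Iio, Set.mem_Ioi, Left.neg_pos_iff,
      and_congr_left_iff]
    intro hx; rw [abs_of_neg hx]
  rw [gaussianReal_eq_add, h1, h2, gaussianReal_neg_preimage (hB.inter measurableSet_Ioi),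
    gaussianReal_inter_Ioi hv]
  ring

theorem gaussianReal_neg_abs_mem (hv : v ≠ 0) {B : Set ℝ} (hB : MeasurableSet B) :
    (gaussianReal 0 v).real {x | -|x| ∈ B} = 2 * (gaussianReal 0 v).real (B ∩ Set.Iio 0) := by
  have hB' : MeasurableSet {x : ℝ | -x ∈ B} := measurable_neg hB
  have h := gaussianReal_abs_mem hv hB'
  have h2 : {x : ℝ | -x ∈ B ∩ Set.Iio 0} = {x | -x ∈ B} ∩ Set.Ioi 0 := by
    ext x; simp
  rw [← gaussianReal_inter_Ioi hv, ← h2,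
    gaussianReal_neg_preimage (hB.inter measurableSet_Iio)] at h
  exact h

theorem uniformBool_real (b : Bool) :
    (PMF.uniformOfFintype Bool).toMeasure.real {b} = 1 / 2 := by
  rw [measureReal_def, PMF.toMeasure_apply_singleton _ _ (measurableSet_singleton b)]
  simp

/-- A parameter is replaced with probability 1/2 · 1/2, which adds a quarter of the Gaussian
everywhere. Of the original values, the nonnegative ones stay and the negative ones stay with weight
1/2. -/
theorem entryLaw_true_real (hv : v ≠ 0) {B : Set ℝ} (hB : MeasurableSet B) :
    (entryLaw v true).real B = 5 / 4 * (gaussianReal 0 v).real (B ∩ Set.Ici 0) +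
      3 / 4 * (gaussianReal 0 v).real (B ∩ Set.Iio 0) := by
  have h : redraw true ⁻¹' B = (B ∩ Set.Ici 0) ×ˢ Set.univ ∪
      ((B ∩ Set.Iio 0) ×ˢ ({false} ×ˢ Set.univ) ∪ Set.Iio 0 ×ˢ ({true} ×ˢ B)) := by
    ext ⟨x, b, y⟩
    rcases lt_or_ge x 0 with hx | hx
    · cases b <;> simp [redraw, hx]
    · simp [redraw, hx, not_lt.2 hx]
  have hB1 := hB.inter (measurableSet_Ici (a := (0 : ℝ)))
  have hB2 := hB.inter (measurableSet_Iio (a := (0 : ℝ)))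
  rw [entryLaw, map_measureReal_apply (measurable_redraw true) hB, h,
    measureReal_union _ (by measurability), measureReal_union _ (by measurability), entryMeasure]
  · simp only [measureReal_prod_prod, uniformBool_real, probReal_univ, gaussianReal_Iio_zero hv]
    rw [gaussianReal_eq_add (B := B)]
    ring
  · refine Set.disjoint_left.2 ?_
    rintro ⟨x, b, y⟩ h1 h2
    simp only [Set.mem_prod, Set.mem_singleton_iff] at h1 h2
    exact absurd (h1.2.1.symm.trans h2.2.1) (by simp)
  · refine Set.disjoint_left.2 ?_
    rintro ⟨x, b, y⟩ h1 h2
    simp only [Set.mem_prod, Set.mem_union, Set.mem_inter_iff, Set.mem_Ici, Set.mem_Iio] at h1 h2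
    rcases h2 with h2 | h2
    · exact absurd h1.1.2 (not_le.2 h2.1.2)
    · exact absurd h1.1.2 (not_le.2 h2.1)

theorem nullSingletonClass_entryLaw (hv : v ≠ 0) (b : Bool) :
    NullSingletonClass (entryLaw v b) := by
  have hg := nullSingletonClass_gaussianReal (μ := 0) hv
  cases b
  · rw [entryLaw_false]; exact hg
  · refine ⟨fun x => ?_⟩
    have h := entryLaw_true_real hv (measurableSet_singleton x)
    have h0 : ∀ s, (gaussianReal 0 v).real ({x} ∩ s) = 0 := fun s => by
      rw [measureReal_def, measure_mono_null Set.inter_subset_left (measure_singleton x)]; rfl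
    rw [h0, h0] at h
    simpa [measureReal_eq_zero_iff] using h

end Gaussian

/-! ### Signs from rotations of a circle of eight -/

section Rotation

/-- A color on a circle of eight, rotated by `t`, decides the sign of a variable: three colors make
it negative. -/
noncomputable def signedBy (t : Fin 8) (p : Fin 8 × ℝ) : ℝ :=
  if p.1 + t < 3 then -|p.2| else |p.2|

theorem measurable_signedBy (t : Fin 8) : Measurable (signedBy t) := by
  unfold signedBy
  refine Measurable.ite ?_ (by fun_prop) (by fun_prop)
  exact measurable_fst (MeasurableSet.of_discrete (s := {c : Fin 8 | c + t < 3}))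

/-- A uniform color and an independent centered Gaussian variable. -/
noncomputable def coloredGaussian (v : NNReal) : Measure (Fin 8 × ℝ) :=
  (PMF.uniformOfFintype (Fin 8)).toMeasure.prod (gaussianReal 0 v)

instance (v : NNReal) : IsProbabilityMeasure (coloredGaussian v) := by
  unfold coloredGaussian; infer_instance

/-- A rotated uniform color is uniform, so the sign is negative with probability 3/8, independently
of the absolute value; this gives densities 2 · 3/8 and 2 · 5/8 relative to the Gaussian, as in
`entryLaw_true_real`. -/
theorem map_signedBy {v : NNReal} (hv : v ≠ 0) (t : Fin 8) :
    (coloredGaussian v).map (signedBy t) = entryLaw v true := by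
  have : IsProbabilityMeasure ((coloredGaussian v).map (signedBy t)) :=
    Measure.isProbabilityMeasure_map (measurable_signedBy t).aemeasurable
  refine Measure.ext fun B hB => ?_
  rw [← ENNReal.toReal_eq_toReal_iff' (measure_ne_top _ _) (measure_ne_top _ _)]
  change Measure.real _ B = Measure.real _ B
  have hS := measurable_signedBy t hB
  let F : Fin 8 → ℝ := fun c => (gaussianReal 0 v).real {x | (if c < 3 then -|x| else |x|) ∈ B}
  have h : (coloredGaussian v).real (signedBy t ⁻¹' B) = ∑ c, 1 / 8 * F (c + t) := by
    rw [measureReal_def, coloredGaussian, Measure.prod_apply hS, lintegral_fintype,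
      ENNReal.toReal_sum fun c _ => ENNReal.mul_ne_top (measure_ne_top _ _) (measure_ne_top _ _)]
    refine Finset.sum_congr rfl fun c _ => ?_
    rw [ENNReal.toReal_mul, mul_comm,
      PMF.toMeasure_apply_singleton _ _ (measurableSet_singleton c)]
    congr 1
    simp
  have hneg := gaussianReal_neg_abs_mem hv hB
  have habs := gaussianReal_abs_mem hv hB
  rw [map_measureReal_apply (measurable_signedBy t) hB, h,
    show ∑ c, 1 / 8 * F (c + t) = ∑ c, 1 / 8 * F c from
      Equiv.sum_comp (Equiv.addRight t) fun c => 1 / 8 * F c, entryLaw_true_real hv hB]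
  have hF : ∀ c : Fin 8, F c = if c < 3 then 2 * (gaussianReal 0 v).real (B ∩ Set.Iio 0)
      else 2 * (gaussianReal 0 v).real (B ∩ Set.Ici 0) := by
    intro c
    by_cases hc : c < 3 <;> simp only [F, hc, if_true, if_false, hneg, habs]
  simp only [hF, Fin.sum_univ_eight]
  simp +decide only [if_true, if_false]
  ring

/-- At most three of the eight arcs of length three on a circle of eight pairwise intersect. -/
theorem card_rotations_le (A : Fin 8 → Prop) [DecidablePred A]
    (h : ∀ s t, A s → A t → ∃ c : Fin 8, c + s < 3 ∧ c + t < 3) :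
    (Finset.univ.filter A).card ≤ 3 := by
  have key : ∀ s t : Fin 8, (¬∃ c : Fin 8, c + s < 3 ∧ c + t < 3) →
      (if A s then 1 else 0) + (if A t then 1 else 0) ≤ 1 := by
    intro s t hst
    have : ¬(A s ∧ A t) := fun hA => hst (h s t hA.1 hA.2)
    split_ifs <;> simp_all
  -- These are all twelve pairs at circular distance three or four. The distance-three pairs form an
  -- 8-cycle, so four chosen vertices would have to alternate along it, and would then contain an
  -- antipodal pair.
  have h03 := key 0 3 (by decide)
  have h04 := key 0 4 (by decide)
  have h05 := key 0 5 (by decide)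
  have h14 := key 1 4 (by decide)
  have h15 := key 1 5 (by decide)
  have h16 := key 1 6 (by decide)
  have h25 := key 2 5 (by decide)
  have h26 := key 2 6 (by decide)
  have h27 := key 2 7 (by decide)
  have h36 := key 3 6 (by decide)
  have h37 := key 3 7 (by decide)
  have h47 := key 4 7 (by decide)
  rw [Finset.card_filter, Fin.sum_univ_eight]
  generalize (if A 0 then 1 else 0) = x₀ at *
  generalize (if A 1 then 1 else 0) = x₁ at *
  generalize (if A 2 then 1 else 0) = x₂ at *
  generalize (if A 3 then 1 else 0) = x₃ at *
  generalize (if A 4 then 1 else 0) = x₄ at *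
  generalize (if A 5 then 1 else 0) = x₅ at *
  generalize (if A 6 then 1 else 0) = x₆ at *
  generalize (if A 7 then 1 else 0) = x₇ at *
  omega

end Rotation
end LPS

namespace LPS

/-! ### Inactivity of one neuron -/

section Neuron

variable {ι : Type*} [Fintype ι] {v : NNReal}

/-- If no variable were negative under both rotations, its two signed copies, having the same
absolute value, would always add up to something nonnegative, and so would the two weighted sums. -/
theorem exists_negative_colors {a : ι → ℝ} (ha : ∀ j, 0 ≤ a j) (p : ι → Fin 8 × ℝ) (s t : Fin 8)
    (hs : ∑ j, a j * signedBy s (p j) < 0) (ht : ∑ j, a j * signedBy t (p j) < 0) :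
    ∃ c : Fin 8, c + s < 3 ∧ c + t < 3 := by
  by_contra! hc
  have h : 0 ≤ ∑ j, (a j * signedBy s (p j) + a j * signedBy t (p j)) := by
    refine Finset.sum_nonneg fun j _ => ?_
    rw [← mul_add]
    refine mul_nonneg (ha j) ?_
    have := hc (p j).1
    have habs := abs_nonneg (p j).2
    unfold signedBy
    split_ifs with h1 h2
    · exact absurd h2 (not_lt.2 (this h1))
    all_goals linarith
  rw [Finset.sum_add_distrib] at h
  linarith

/-- All eight rotations yield the same law, while for each outcome of colors and Gaussians at most
three of them fall in the event. Hence eight times its probability is at most three. -/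
theorem pi_weightedSum_neg_le {a : ι → ℝ} (hv : v ≠ 0) (ha : ∀ j, 0 ≤ a j) :
    (Measure.pi fun _ : ι => entryLaw v true).real {w | ∑ j, a j * w j < 0} ≤ 3 / 8 := by
  classical
  set E : Set (ι → ℝ) := {w | ∑ j, a j * w j < 0}
  have hE : MeasurableSet E := measurableSet_lt (measurable_weightedSum a) measurable_const
  let ρ := Measure.pi fun _ : ι => coloredGaussian v
  let H : Fin 8 → (ι → Fin 8 × ℝ) → ι → ℝ := fun t p j => signedBy t (p j)
  have hH : ∀ t, MeasurePreserving (H t) ρ (Measure.pi fun _ : ι => entryLaw v true) := fun t =>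
    measurePreserving_pi _ _ fun _ => ⟨measurable_signedBy t, map_signedBy hv t⟩
  have h1 : ∑ t : Fin 8, ρ (H t ⁻¹' E) ≤ 3 := by
    calc ∑ t : Fin 8, ρ (H t ⁻¹' E)
        = ∫⁻ p, ∑ t : Fin 8, (H t ⁻¹' E).indicator 1 p ∂ρ := by
          rw [lintegral_finsetSum _ fun t _ => measurable_one.indicator ((hH t).measurable hE)]
          exact Finset.sum_congr rfl fun t _ =>
            (lintegral_indicator_one ((hH t).measurable hE)).symm
      _ ≤ ∫⁻ _, 3 ∂ρ := by
          refine lintegral_mono fun p => ?_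
          have h : (Finset.univ.filter fun t => H t p ∈ E).card ≤ 3 :=
            card_rotations_le (fun t => H t p ∈ E) fun s t hs ht => exists_negative_colors ha p s t hs ht
          have h' : ∑ t : Fin 8, (H t ⁻¹' E).indicator (1 : (ι → Fin 8 × ℝ) → ENNReal) p =
              ((Finset.univ.filter fun t => H t p ∈ E).card : ENNReal) := by
            rw [Finset.card_filter]
            push_cast
            exact Finset.sum_congr rfl fun t _ => by simp [Set.indicator_apply]
          rw [h']
          show _ ≤ (3 : ENNReal)
          exact_mod_cast h
      _ = 3 := by simp
  simp only [fun t => (hH t).measure_preimage hE.nullMeasurableSet, Finset.sum_const,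
    Finset.card_univ, Fintype.card_fin] at h1
  have h2 := ENNReal.toReal_mono (by simp) h1
  rw [ENNReal.toReal_nsmul] at h2
  simp only [nsmul_eq_mul, Nat.cast_ofNat, ENNReal.toReal_ofNat] at h2
  rw [measureReal_def]
  linarith

/-- The bound on the probability that a single neuron is inactive at a given point. -/
noncomputable def inactiveProb (b : Bool) : ℝ := if b then 3 / 8 else 1 / 2

theorem inactiveProb_nonneg (b : Bool) : 0 ≤ inactiveProb b := by
  unfold inactiveProb; split_ifs <;> norm_num

theorem inactiveProb_le_one (b : Bool) : inactiveProb b ≤ 1 := by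
  unfold inactiveProb; split_ifs <;> norm_num

theorem pi_weightedSum_nonpos_le (hv : v ≠ 0) (b : Bool) {a : ι → ℝ} (ha : ∀ j, 0 ≤ a j) {i : ι}
    (hi : a i ≠ 0) :
    (Measure.pi fun _ : ι => entryLaw v b).real {w | ∑ j, a j * w j ≤ 0} ≤ inactiveProb b := by
  have hn := nullSingletonClass_entryLaw hv b
  cases b
  · refine pi_weightedSum_nonpos_le_half _ ?_ hi
    rw [entryLaw_false, gaussianReal_map_neg, neg_zero]
  · have hsub : {w : ι → ℝ | ∑ j, a j * w j ≤ 0} ⊆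
        {w | ∑ j, a j * w j < 0} ∪ {w | ∑ j, a j * w j = 0} := fun w hw =>
      le_iff_lt_or_eq.1 (show ∑ j, a j * w j ≤ 0 from hw)
    refine (measureReal_mono hsub).trans ((measureReal_union_le _ _).trans ?_)
    rw [(measureReal_eq_zero_iff).2 (pi_hyperplane_eq_zero _ hi), add_zero]
    exact pi_weightedSum_neg_le hv ha

end Neuron

/-! ### Inactivity and collisions in one layer -/

section Layer

variable {a d : ℕ} {v : NNReal}

/-- The law of the parameters of a layer that is chosen iff `b`. -/
noncomputable def layerLaw (a d : ℕ) (v : NNReal) (b : Bool) : Measure (LayerParams a d) :=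
  Measure.pi fun _ => Measure.pi fun _ => entryLaw v b

instance (v : NNReal) (b : Bool) : IsProbabilityMeasure (layerLaw a d v b) := by
  unfold layerLaw; infer_instance

theorem affine_eq_weightedSum (L : LayerParams a d) (z : Fin a → ℝ) (s : Fin d) :
    affine L z s = ∑ j : Option (Fin a), (j.elim 1 z) * L s j := by
  simp [affine, Fintype.sum_option, add_comm, mul_comm]

theorem continuous_affine : Continuous fun p : LayerParams a d × (Fin a → ℝ) => affine p.1 p.2 := by
  unfold affine; fun_prop

theorem layerLaw_inactive_le (hv : v ≠ 0) (b : Bool) {z : Fin a → ℝ} (hz : ∀ k, 0 ≤ z k) :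
    (layerLaw a d v b).real {L | ∀ s, affine L z s ≤ 0} ≤ inactiveProb b ^ d := by
  have h : {L : LayerParams a d | ∀ s, affine L z s ≤ 0} =
      Set.univ.pi fun _ => {w | ∑ j : Option (Fin a), (j.elim 1 z) * w j ≤ 0} := by
    ext L
    simp only [affine_eq_weightedSum, Set.mem_ofPred_eq, Set.mem_univ_pi]
  rw [h, measureReal_def, layerLaw, Measure.pi_pi, ENNReal.toReal_prod]
  -- The bias has coefficient 1, so the linear form is nonzero even when `z = 0`.
  have hn := pi_weightedSum_nonpos_le hv b (a := fun j : Option (Fin a) => j.elim 1 z)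
    (fun j => by cases j <;> simp [hz]) (i := none) (by simp)
  refine (Finset.prod_le_prod (fun _ _ => ENNReal.toReal_nonneg) fun _ _ => hn).trans ?_
  simp

/-- The bias cancels in the difference, leaving a linear form in the weights that is nonzero where
`z` and `z'` differ. -/
theorem layerLaw_collision_eq_zero (hv : v ≠ 0) (b : Bool) {z z' : Fin a → ℝ} (hz : z ≠ z') :
    layerLaw a d v b {L | ∃ s, affine L z s = affine L z' s} = 0 := by
  have hn := nullSingletonClass_entryLaw hv b
  obtain ⟨k, hk⟩ := Function.ne_iff.1 hz
  rw [Set.ofPred_exists, measure_iUnion_null_iff]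
  intro s
  have h : {L : LayerParams a d | affine L z s = affine L z' s} = Function.eval s ⁻¹'
      {w | ∑ j : Option (Fin a), (j.elim 0 fun k => z k - z' k) * w j = 0} := by
    ext L
    simp only [Set.mem_ofPred_eq, Set.mem_preimage, Function.eval, Fintype.sum_option,
      Option.elim, zero_mul, zero_add, sub_mul, Finset.sum_sub_distrib, sub_eq_zero, affine,
      add_left_inj]
    simp only [mul_comm]
  rw [h, layerLaw]
  refine (Measure.quasiMeasurePreserving_eval _ s).preimage_null
    (pi_hyperplane_eq_zero (i := some k) _ ?_)
  simpa [sub_eq_zero] using hk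

end Layer
end LPS

/-! ### Propagation of non-constancy through the network -/

namespace LPS

/-- This replaces conditioning on the other layers: redraw layer `i` and integrate over `A`. -/
theorem mul_pi_real_le_of_update {ι : Type*} [Fintype ι] [DecidableEq ι] {α : ι → Type*}
    [∀ i, MeasurableSpace (α i)] (μ : ∀ i, Measure (α i)) [∀ i, IsProbabilityMeasure (μ i)] (i : ι)
    {A B : Set (∀ j, α j)} (hA : MeasurableSet A) (hB : MeasurableSet B) {c : ℝ} (hc : 0 ≤ c)
    (h : ∀ x ∈ A, c ≤ (μ i).real {y | Function.update x i y ∈ B}) :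
    c * (Measure.pi μ).real A ≤ (Measure.pi μ).real B := by
  have key : ENNReal.ofReal c * Measure.pi μ A ≤ Measure.pi μ B := by
    rw [pi_apply_eq_lintegral_update μ i hB, ← lintegral_indicator_const hA]
    refine lintegral_mono fun x => ?_
    by_cases hx : x ∈ A
    · simpa only [Set.indicator_of_mem hx] using
        ENNReal.ofReal_le_of_le_toReal (h x hx)
    · simp [Set.indicator_of_notMem hx]
  have h2 := ENNReal.toReal_mono (measure_ne_top _ _) key
  rwa [ENNReal.toReal_mul, ENNReal.toReal_ofReal hc] at h2

section Network

variable {n : ℕ} {m : ℕ → ℕ}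

/-- The vector that enters layer `ℓ + 1`. -/
def layerInput (θ : Params n m) (x : Fin (m 0) → ℝ) : (ℓ : ℕ) → ℓ ≤ n → Fin (m ℓ) → ℝ
  | 0, _ => x
  | ℓ + 1, h => relu (preact θ x (ℓ + 1) h)

theorem preact_succ (θ : Params n m) (x : Fin (m 0) → ℝ) (ℓ : ℕ) (h : ℓ + 1 ≤ n) :
    preact θ x (ℓ + 1) h = affine (θ ⟨ℓ, h⟩) (layerInput θ x ℓ (Nat.le_of_succ_le h)) := by
  cases ℓ <;> simp only [preact, layerInput]

theorem layerInput_succ (θ : Params n m) (x : Fin (m 0) → ℝ) (ℓ : ℕ) (h : ℓ + 1 ≤ n) :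
    layerInput θ x (ℓ + 1) h =
      relu (affine (θ ⟨ℓ, h⟩) (layerInput θ x ℓ (Nat.le_of_succ_le h))) := by
  rw [layerInput, preact_succ]

/-- This is why `0` is the base point: the first layer's input has not passed through `relu`, yet
the 3/8 bound needs nonnegative coefficients. -/
theorem layerInput_zero_nonneg (θ : Params n m) (ℓ : ℕ) (h : ℓ ≤ n) (k : Fin (m ℓ)) :
    0 ≤ layerInput θ 0 ℓ h k := by
  cases ℓ with
  | zero => simp [layerInput]
  | succ ℓ => exact le_max_left _ _

theorem layerInput_update (θ : Params n m) (x : Fin (m 0) → ℝ) (i : Fin n)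
    (L : LayerParams (m i) (m (i + 1))) (ℓ : ℕ) (h : ℓ ≤ n) (hi : ℓ ≤ i) :
    layerInput (Function.update θ i L) x ℓ h = layerInput θ x ℓ h := by
  induction ℓ with
  | zero => rfl
  | succ ℓ ih =>
    rw [layerInput_succ, layerInput_succ, ih _ (by omega), Function.update_of_ne]
    rintro rfl
    exact absurd hi (by simp)

theorem continuous_relu {a : ℕ} : Continuous (relu : (Fin a → ℝ) → Fin a → ℝ) := by
  unfold relu; fun_prop

theorem continuous_layerInput (x : Fin (m 0) → ℝ) (ℓ : ℕ) (h : ℓ ≤ n) :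
    Continuous fun θ : Params n m => layerInput θ x ℓ h := by
  induction ℓ with
  | zero => exact continuous_const
  | succ ℓ ih =>
    have hp : Continuous fun θ : Params n m =>
        ((θ ⟨ℓ, h⟩, layerInput θ x ℓ (Nat.le_of_succ_le h)) :
          LayerParams (m ℓ) (m (ℓ + 1)) × (Fin (m ℓ) → ℝ)) :=
      Continuous.prodMk (continuous_apply (⟨ℓ, h⟩ : Fin n)) (ih (Nat.le_of_succ_le h))
    simp only [layerInput_succ]
    exact continuous_relu.comp (continuous_affine.comp hp)

theorem continuous_preact_succ (x : Fin (m 0) → ℝ) (ℓ : ℕ) (h : ℓ + 1 ≤ n) :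
    Continuous fun θ : Params n m => preact θ x (ℓ + 1) h := by
  have hp : Continuous fun θ : Params n m =>
      ((θ ⟨ℓ, h⟩, layerInput θ x ℓ (Nat.le_of_succ_le h)) :
        LayerParams (m ℓ) (m (ℓ + 1)) × (Fin (m ℓ) → ℝ)) :=
    Continuous.prodMk (continuous_apply (⟨ℓ, h⟩ : Fin n)) (continuous_layerInput x ℓ _)
  simp only [preact_succ]
  exact continuous_affine.comp hp

/-- The parameters for which the input of layer `ℓ + 1` is not constant on `D`. -/
def varying (D : Set (Fin (m 0) → ℝ)) (ℓ : ℕ) (h : ℓ ≤ n) : Set (Params n m) :=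
  {θ | ∃ x ∈ D, layerInput θ x ℓ h ≠ layerInput θ 0 ℓ h}

theorem measurableSet_varying (D : Set (Fin (m 0) → ℝ)) (ℓ : ℕ) (h : ℓ ≤ n) :
    MeasurableSet (varying D ℓ h : Set (Params n m)) := by
  have : (varying D ℓ h : Set (Params n m)) =
      ⋃ x ∈ D, {θ | layerInput θ x ℓ h ≠ layerInput θ 0 ℓ h} := by
    ext θ; simp [varying]
  rw [this]
  exact (isOpen_biUnion fun x _ =>
    isOpen_ne_fun (continuous_layerInput x ℓ h) (continuous_layerInput 0 ℓ h)).measurableSet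

theorem bornDead_iff {D : Set (Fin (m 0) → ℝ)} (h0 : 0 ∈ D) (θ : Params n m) :
    BornDead θ D ↔ ∀ x ∈ D, network θ x = network θ 0 :=
  ⟨fun ⟨_, h⟩ x hx => (h x hx).trans (h 0 h0).symm, fun h => ⟨_, h⟩⟩

theorem measurableSet_bornDead (hn : 1 ≤ n) {D : Set (Fin (m 0) → ℝ)} (h0 : 0 ∈ D) :
    MeasurableSet {θ : Params n m | BornDead θ D} := by
  obtain ⟨n, rfl⟩ := Nat.exists_eq_add_of_le' hn
  have : {θ : Params (n + 1) m | BornDead θ D} =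
      ⋂ x ∈ D, {θ | network θ x = network θ 0} := by
    ext θ; simp [bornDead_iff h0]
  rw [this]
  exact (isClosed_biInter fun x _ =>
    isClosed_eq (continuous_preact_succ x n le_rfl) (continuous_preact_succ 0 n le_rfl)).measurableSet

/-- The law of the parameters when the chosen layers are given by `r`. -/
noncomputable def paramsLaw (v : ℕ → NNReal) (r : Fin n → Bool) : Measure (Params n m) :=
  Measure.pi fun ℓ : Fin n => layerLaw (m ℓ) (m (ℓ + 1)) (v (ℓ + 1)) (r ℓ)

instance (v : ℕ → NNReal) (r : Fin n → Bool) :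
    IsProbabilityMeasure (paramsLaw v r : Measure (Params n m)) := by
  unfold paramsLaw; infer_instance

/-- A bound on the conditional probability that layer `ℓ + 1` is inactive. -/
noncomputable def layerInactiveProb (m : ℕ → ℕ) (r : Fin n → Bool) (ℓ : Fin n) : ℝ :=
  inactiveProb (r ℓ) ^ m (ℓ + 1)

theorem layerInactiveProb_le_one (r : Fin n → Bool) (ℓ : Fin n) :
    layerInactiveProb m r ℓ ≤ 1 :=
  pow_le_one₀ (inactiveProb_nonneg _) (inactiveProb_le_one _)

variable {v : ℕ → NNReal} {r : Fin n → Bool} {D : Set (Fin (m 0) → ℝ)}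

/-- A neuron active at `0` separates `x` from `0` after `relu` unless its two affine values
coincide, a null event. So variation is lost only when the whole layer is inactive at `0`. -/
theorem varying_succ_real_ge (hv : ∀ ℓ : Fin n, v (ℓ + 1) ≠ 0) (ℓ : ℕ) (h : ℓ + 1 ≤ n) :
    (1 - layerInactiveProb m r ⟨ℓ, h⟩) * (paramsLaw v r).real
        (varying D ℓ (Nat.le_of_succ_le h) : Set (Params n m)) ≤
      (paramsLaw v r).real (varying D (ℓ + 1) h : Set (Params n m)) := by
  refine mul_pi_real_le_of_update _ ⟨ℓ, h⟩ (measurableSet_varying D _ _)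
    (measurableSet_varying D _ _) (sub_nonneg.2 (layerInactiveProb_le_one _ _)) ?_
  rintro θ ⟨x, hx, hne⟩
  set z := layerInput θ x ℓ (Nat.le_of_succ_le h)
  set z₀ := layerInput θ 0 ℓ (Nat.le_of_succ_le h) with hz₀
  set μ := layerLaw (m ℓ) (m (ℓ + 1)) (v (ℓ + 1)) (r ⟨ℓ, h⟩)
  have hdead : μ.real {L | ∀ s, affine L z₀ s ≤ 0} ≤ layerInactiveProb m r ⟨ℓ, h⟩ :=
    layerLaw_inactive_le (hv ⟨ℓ, h⟩) _ (layerInput_zero_nonneg θ ℓ _)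
  have hcoll : μ.real {L | ∃ s, affine L z s = affine L z₀ s} = 0 :=
    (measureReal_eq_zero_iff).2 (layerLaw_collision_eq_zero (hv ⟨ℓ, h⟩) _ hne)
  have hcover : (Set.univ : Set (LayerParams (m ℓ) (m (ℓ + 1)))) ⊆
      {L | Function.update θ ⟨ℓ, h⟩ L ∈ varying D (ℓ + 1) h} ∪
        ({L | ∀ s, affine L z₀ s ≤ 0} ∪ {L | ∃ s, affine L z s = affine L z₀ s}) := by
    intro L _
    by_contra hL
    simp only [Set.mem_union, Set.mem_ofPred_eq, not_or, not_forall, not_exists, not_le] at hL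
    obtain ⟨hvar, ⟨s, hs⟩, hcol⟩ := hL
    refine hvar ⟨x, hx, fun heq => hcol s ?_⟩
    rw [layerInput_succ, layerInput_succ, layerInput_update _ _ _ _ _ _ le_rfl,
      layerInput_update _ _ _ _ _ _ le_rfl, Function.update_self] at heq
    have := congrFun heq s
    simp only [relu] at this
    rw [max_eq_right hs.le] at this
    rcases max_choice 0 (affine L z s) with h1 | h1 <;> rw [h1] at this
    · exact absurd this hs.ne
    · exact this
  have h1 := (measureReal_mono hcover (μ := μ)).trans
    ((measureReal_union_le _ _).trans (add_le_add_right (measureReal_union_le _ _) _))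
  rw [probReal_univ, hcoll] at h1
  change _ ≤ μ.real _
  linarith

theorem varying_zero (hD : ∃ x ∈ D, x ≠ 0) :
    (varying D 0 (Nat.zero_le n) : Set (Params n m)) = Set.univ :=
  Set.eq_univ_of_forall fun _ => hD

theorem prod_le_varying_real (hv : ∀ ℓ : Fin n, v (ℓ + 1) ≠ 0) (hD : ∃ x ∈ D, x ≠ 0) (ℓ : ℕ)
    (h : ℓ ≤ n) :
    ∏ i : Fin ℓ, (1 - layerInactiveProb m r (Fin.castLE h i)) ≤
      (paramsLaw v r).real (varying D ℓ h : Set (Params n m)) := by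
  induction ℓ with
  | zero => rw [varying_zero hD, probReal_univ]; simp
  | succ ℓ ih =>
    refine le_trans ?_ (varying_succ_real_ge hv ℓ h)
    rw [Fin.prod_univ_castSucc, mul_comm]
    exact mul_le_mul_of_nonneg_left (ih (Nat.le_of_succ_le h))
      (sub_nonneg.2 (layerInactiveProb_le_one _ _))

/-- The last layer is affine, so it almost surely keeps the variation of its input; only the `n`
hidden layers contribute factors. -/
theorem bornDead_real_le {v : ℕ → NNReal} {r : Fin (n + 1) → Bool}
    (hv : ∀ ℓ : Fin (n + 1), v (ℓ + 1) ≠ 0) (hm : 1 ≤ m (n + 1))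
    (h0 : 0 ∈ D) (hD : ∃ x ∈ D, x ≠ 0) :
    (paramsLaw v r).real {θ : Params (n + 1) m | BornDead θ D} ≤
      1 - ∏ i : Fin n, (1 - layerInactiveProb m r i.castSucc) := by
  have hmeas := measurableSet_bornDead (m := m) (Nat.le_add_left 1 n) h0
  have h1 := prod_le_varying_real (r := r) (m := m) hv hD n n.le_succ
  have h2 : 1 * (paramsLaw v r).real (varying D n n.le_succ : Set (Params (n + 1) m)) ≤
      (paramsLaw v r).real {θ : Params (n + 1) m | BornDead θ D}ᶜ := by
    refine mul_pi_real_le_of_update _ ⟨n, n.lt_succ_self⟩ (measurableSet_varying D _ _) hmeas.compl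
      zero_le_one ?_
    rintro θ ⟨x, hx, hne⟩
    set μ := layerLaw (m n) (m (n + 1)) (v (n + 1)) (r ⟨n, n.lt_succ_self⟩)
    have hcoll := (measureReal_eq_zero_iff (μ := μ)).2
      (layerLaw_collision_eq_zero (hv ⟨n, n.lt_succ_self⟩) _ hne)
    have hcover : (Set.univ : Set (LayerParams (m n) (m (n + 1)))) ⊆
        {L | Function.update θ (⟨n, n.lt_succ_self⟩) L ∈ {θ : Params (n + 1) m | BornDead θ D}ᶜ} ∪
          {L | ∃ s, affine L (layerInput θ x n n.le_succ) s =
            affine L (layerInput θ 0 n n.le_succ) s} := by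
      intro L _
      by_contra hL
      simp only [Set.mem_union, Set.mem_ofPred_eq, not_or, not_exists, Set.mem_compl_iff,
        not_not] at hL
      have h := (bornDead_iff h0 _).1 hL.1 x hx
      rw [network, network, preact_succ, preact_succ, layerInput_update _ _ _ _ _ _ le_rfl,
        layerInput_update _ _ _ _ _ _ le_rfl,
        Function.update_self] at h
      exact hL.2 ⟨0, hm⟩ (congrFun h _)
    have h3 := (measureReal_mono hcover (μ := μ)).trans (measureReal_union_le _ _)
    rwa [probReal_univ, hcoll, add_zero] at h3
  rw [probReal_compl_eq_one_sub hmeas] at h2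
  have h3 : ∏ i : Fin n, (1 - layerInactiveProb m r (Fin.castLE n.le_succ i)) =
      ∏ i : Fin n, (1 - layerInactiveProb m r i.castSucc) := rfl
  linarith

end Network
end LPS

namespace LPS

/-! ### Averaging over dependent choices of layers -/

section Averaging

/-- The relative gain of a layer of width `M` if a chosen neuron is inactive with probability
`x / 2` in place of `1 / 2`. -/
noncomputable def gain (x : ℝ) (M : ℕ) : ℝ := (1 - x ^ M) / (2 ^ M - 1)

theorem one_le_two_pow_sub_one {M : ℕ} (hM : 1 ≤ M) : (1 : ℝ) ≤ 2 ^ M - 1 := by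
  have := pow_le_pow_right₀ (one_le_two (α := ℝ)) hM
  linarith

theorem gain_nonneg {x : ℝ} (hx : 0 ≤ x) (hx1 : x ≤ 1) {M : ℕ} (hM : 1 ≤ M) : 0 ≤ gain x M :=
  div_nonneg (sub_nonneg.2 (pow_le_one₀ hx hx1)) (by linarith [one_le_two_pow_sub_one hM])

theorem gain_le_one {x : ℝ} (hx : 0 ≤ x) {M : ℕ} (hM : 1 ≤ M) : gain x M ≤ 1 := by
  have h := one_le_two_pow_sub_one hM
  have := pow_nonneg hx M
  rw [gain, div_le_one (by linarith)]
  linarith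

theorem sq_succ_le (k : ℕ) : ((k : ℝ) + 1) ^ 2 ≤ 8 * (7 / 4) ^ k := by
  rcases lt_or_ge k 3 with hk | hk
  · interval_cases k <;> norm_num
  · induction k, hk using Nat.le_induction with
    | base => norm_num
    | succ k hk ih =>
      have : (3 : ℝ) ≤ k := by exact_mod_cast hk
      push_cast
      rw [pow_succ (7 / 4 : ℝ)]
      nlinarith

/-- The drop from rate 3/4 to 7/8 pays for the square. With `M = k + 1`, Bernoulli's inequality and
`2 ^ M - 1 ≥ 2 ^ k` reduce this to `sq_succ_le`. -/
theorem gain_sq_add_le {M : ℕ} (hM : 1 ≤ M) :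
    gain (7 / 8) M ^ 2 + gain (7 / 8) M ≤ gain (3 / 4) M := by
  have hD := one_le_two_pow_sub_one hM
  suffices h : (1 - (7 / 8 : ℝ) ^ M) ^ 2 ≤ (2 ^ M - 1) * ((7 / 8) ^ M - (3 / 4) ^ M) by
    unfold gain
    rw [div_pow, ← sub_nonneg]
    have : (1 - (3 / 4 : ℝ) ^ M) / (2 ^ M - 1) -
        ((1 - (7 / 8 : ℝ) ^ M) ^ 2 / (2 ^ M - 1) ^ 2 + (1 - (7 / 8) ^ M) / (2 ^ M - 1)) =
        ((2 ^ M - 1) * ((7 / 8) ^ M - (3 / 4) ^ M) - (1 - (7 / 8 : ℝ) ^ M) ^ 2) /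
          (2 ^ M - 1) ^ 2 := by
      have : (2 : ℝ) ^ M - 1 ≠ 0 := by linarith
      field_simp
      ring
    rw [this]
    exact div_nonneg (sub_nonneg.2 h) (sq_nonneg _)
  obtain ⟨k, rfl⟩ := Nat.exists_eq_add_of_le' hM
  have h1 : 1 - (7 / 8 : ℝ) ^ (k + 1) ≤ (k + 1) / 8 := by
    have := one_add_mul_le_pow (show (-2 : ℝ) ≤ -1 / 8 by norm_num) (k + 1)
    norm_num at this ⊢
    linarith
  have h0 : 0 ≤ 1 - (7 / 8 : ℝ) ^ (k + 1) :=
    sub_nonneg.2 (pow_le_one₀ (by norm_num) (by norm_num))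
  have h2 : (2 : ℝ) ^ k ≤ 2 ^ (k + 1) - 1 := by
    have := one_le_pow₀ (one_le_two (α := ℝ)) (n := k)
    rw [pow_succ]; linarith
  have h3 : (7 / 8 : ℝ) ^ k / 8 ≤ (7 / 8) ^ (k + 1) - (3 / 4) ^ (k + 1) := by
    have := pow_le_pow_left₀ (by norm_num) (show (3 / 4 : ℝ) ≤ 7 / 8 by norm_num) k
    rw [pow_succ, pow_succ]; linarith
  have h4 := mul_le_mul h2 h3 (by positivity) (by linarith [h2, pow_pos (two_pos (α := ℝ)) k])
  have h5 : (2 : ℝ) ^ k * ((7 / 8) ^ k / 8) = (7 / 4) ^ k / 8 := by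
    rw [mul_div_assoc', ← mul_pow]; norm_num
  have h6 := pow_le_pow_left₀ h0 h1 2
  have h7 := sq_succ_le k
  rw [h5] at h4
  rw [div_pow ((k : ℝ) + 1)] at h6
  linarith

theorem one_add_sum_le_prod {ι : Type*} (s : Finset ι) {f : ι → ℝ} (hf : ∀ i ∈ s, 0 ≤ f i) :
    1 + ∑ i ∈ s, f i ≤ ∏ i ∈ s, (1 + f i) := by
  classical
  induction s using Finset.induction_on with
  | empty => simp
  | insert a s ha ih =>
    rw [Finset.sum_insert ha, Finset.prod_insert ha]
    have h := ih fun i hi => hf i (Finset.mem_insert_of_mem hi)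
    have h0 := hf a (Finset.mem_insert_self a s)
    have hs : 0 ≤ ∑ i ∈ s, f i :=
      Finset.sum_nonneg fun i hi => hf i (Finset.mem_insert_of_mem hi)
    nlinarith [mul_nonneg h0 hs]

/-- With `S = ∑ p f ≤ 1`, the product is at most `exp S ≤ 1 + S + S ^ 2`, and Cauchy–Schwarz with
weights `p` bounds `S ^ 2` by `∑ p f ^ 2`. -/
theorem prod_one_add_mul_le {ι : Type*} (s : Finset ι) {p f : ι → ℝ} (hp : ∀ i ∈ s, 0 ≤ p i)
    (hs : ∑ i ∈ s, p i ≤ 1) (hf : ∀ i ∈ s, 0 ≤ f i) (hf1 : ∀ i ∈ s, f i ≤ 1) :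
    ∏ i ∈ s, (1 + p i * f i) ≤ 1 + ∑ i ∈ s, p i * (f i ^ 2 + f i) := by
  set S := ∑ i ∈ s, p i * f i
  have hS0 : 0 ≤ S := Finset.sum_nonneg fun i hi => mul_nonneg (hp i hi) (hf i hi)
  have hS1 : S ≤ 1 := (Finset.sum_le_sum fun i hi =>
    mul_le_of_le_one_right (hp i hi) (hf1 i hi)).trans hs
  have h1 : ∏ i ∈ s, (1 + p i * f i) ≤ Real.exp S := by
    rw [Real.exp_sum]
    refine Finset.prod_le_prod
      (fun i hi => add_nonneg zero_le_one (mul_nonneg (hp i hi) (hf i hi))) fun i _ => ?_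
    rw [add_comm]
    exact Real.add_one_le_exp _
  have h2 := (abs_le.1 (Real.abs_exp_sub_one_sub_id_le (abs_le.2 ⟨by linarith, hS1⟩))).2
  have hq : 0 ≤ ∑ i ∈ s, p i * f i ^ 2 :=
    Finset.sum_nonneg fun i hi => mul_nonneg (hp i hi) (sq_nonneg _)
  have h3 : S ^ 2 ≤ (∑ i ∈ s, p i) * ∑ i ∈ s, p i * f i ^ 2 :=
    Finset.sum_sq_le_sum_mul_sum_of_sq_le_mul s hp
      (fun i hi => mul_nonneg (hp i hi) (sq_nonneg _)) fun i _ => le_of_eq (by ring)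
  have h4 : (∑ i ∈ s, p i) * ∑ i ∈ s, p i * f i ^ 2 ≤ ∑ i ∈ s, p i * f i ^ 2 :=
    mul_le_of_le_one_left hq hs
  simp only [mul_add, Finset.sum_add_distrib]
  linarith

/-- Here and in `one_sub_mixture_pow` the factor of an unchosen layer is split off; what remains is
affine in the indicator, respectively in its mean. -/
theorem one_sub_inactiveProb_pow {M : ℕ} (hM : 1 ≤ M) (b : Bool) :
    1 - inactiveProb b ^ M =
      (1 - (2 : ℝ)⁻¹ ^ M) * (1 + (if b = true then 1 else 0) * gain (3 / 4) M) := by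
  have h : (2 : ℝ) ^ M - 1 ≠ 0 := by linarith [one_le_two_pow_sub_one hM]
  have h2 : (3 / 8 : ℝ) ^ M = (3 / 4) ^ M * (2⁻¹) ^ M := by rw [← mul_pow]; norm_num
  cases b
  · simp [inactiveProb]
  · simp only [inactiveProb, gain, if_true, h2, inv_pow]
    field_simp
    ring

theorem one_sub_mixture_pow {M : ℕ} (hM : 1 ≤ M) (p x : ℝ) :
    1 - (2 : ℝ)⁻¹ ^ M * ((1 - p) + p * x ^ M) = (1 - (2 : ℝ)⁻¹ ^ M) * (1 + p * gain x M) := by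
  have h : (2 : ℝ) ^ M - 1 ≠ 0 := by linarith [one_le_two_pow_sub_one hM]
  simp only [gain, inv_pow]
  field_simp
  ring

/-- Averaging the product of the conditional bounds over any joint law of the choices. -/
theorem prod_mixture_le_average {Ω ι : Type*} [Fintype Ω] [Fintype ι] {w : Ω → ℝ}
    (hw : ∀ r, 0 ≤ w r) (hw1 : ∑ r, w r = 1) (χ : Ω → ι → Bool) {p : ι → ℝ}
    (hχ : ∀ i, ∑ r, w r * (if χ r i = true then 1 else 0) = p i) (hp : ∑ i, p i ≤ 1) {M : ι → ℕ}
    (hM : ∀ i, 1 ≤ M i) :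
    ∏ i, (1 - (2 : ℝ)⁻¹ ^ M i * ((1 - p i) + p i * (7 / 8) ^ M i)) ≤
      ∑ r, w r * ∏ i, (1 - inactiveProb (χ r i) ^ M i) := by
  have hp0 : ∀ i, 0 ≤ p i := fun i => by
    rw [← hχ]
    exact Finset.sum_nonneg fun r _ => mul_nonneg (hw r) (by split_ifs <;> norm_num)
  have hg : ∀ i, 0 ≤ gain (3 / 4) (M i) := fun i => gain_nonneg (by norm_num) (by norm_num) (hM i)
  have h0 : 0 ≤ ∏ i, (1 - (2 : ℝ)⁻¹ ^ M i) :=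
    Finset.prod_nonneg fun i _ => sub_nonneg.2 (pow_le_one₀ (by norm_num) (by norm_num))
  simp only [one_sub_mixture_pow (hM _), one_sub_inactiveProb_pow (hM _), Finset.prod_mul_distrib,
    mul_left_comm (w _), ← Finset.mul_sum]
  refine mul_le_mul_of_nonneg_left ?_ h0
  calc ∏ i, (1 + p i * gain (7 / 8) (M i))
      ≤ 1 + ∑ i, p i * (gain (7 / 8) (M i) ^ 2 + gain (7 / 8) (M i)) :=
        prod_one_add_mul_le _ (fun i _ => hp0 i) hp
          (fun i _ => gain_nonneg (by norm_num) (by norm_num) (hM i))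
          fun i _ => gain_le_one (by norm_num) (hM i)
    _ ≤ 1 + ∑ i, p i * gain (3 / 4) (M i) := by
        gcongr with i _
        · exact hp0 i
        · exact gain_sq_add_le (hM i)
    _ = ∑ r, w r * (1 + ∑ i, (if χ r i = true then 1 else 0) * gain (3 / 4) (M i)) := by
        simp only [mul_add, mul_one, Finset.sum_add_distrib, hw1, ← hχ, Finset.sum_mul,
          Finset.mul_sum]
        rw [Finset.sum_comm]
        simp only [mul_assoc]
    _ ≤ _ := by
        refine Finset.sum_le_sum fun r _ => mul_le_mul_of_nonneg_left ?_ (hw r)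
        exact one_add_sum_le_prod _ fun i _ => mul_nonneg (by split_ifs <;> norm_num) (hg i)

theorem sum_layerProb_le_one (n : ℕ) : ∑ i : Fin n, layerProb (n + 1) (i + 1) ≤ 1 := by
  have h : ∑ i : Fin n, (2 : ℝ) ^ ((i : ℕ) + 1) = 2 ^ (n + 1) - 2 := by
    rw [Fin.sum_univ_eq_sum_range fun i => (2 : ℝ) ^ (i + 1)]
    induction n with
    | zero => simp
    | succ n ih => rw [Finset.sum_range_succ, ih]; ring
  have h1 : (1 : ℝ) ≤ 2 ^ n := one_le_pow₀ one_le_two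
  simp only [layerProb, ← Finset.sum_div, h]
  rw [div_le_one (by rw [pow_succ, pow_succ]; linarith), pow_succ, pow_succ, pow_succ]
  linarith

end Averaging

/-! ### Conditioning on the choice of layers -/

section Experiment

variable {n : ℕ} {m : ℕ → ℕ}

theorem map_reinit (r : Fin n → Bool) :
    Measurable (reinit r : Draws n m → Params n m) ∧
      (drawMeasure n m).map (reinit r) = paramsLaw (variance n m) r := by
  have h : MeasurePreserving (fun (ω : Draws n m) ℓ s k => redraw (r ℓ) (ω ℓ s k))
      (drawMeasure n m) (paramsLaw (variance n m) r) := by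
    have hneuron (a : ℕ) (v : NNReal) (b : Bool) :
        MeasurePreserving (fun (w : Option (Fin a) → ℝ × Bool × ℝ) k => redraw b (w k))
          (Measure.pi fun _ => entryMeasure v) (Measure.pi fun _ => entryLaw v b) :=
      measurePreserving_pi _ _ fun _ => ⟨measurable_redraw b, rfl⟩
    have hlayer (a d : ℕ) (v : NNReal) (b : Bool) :
        MeasurePreserving
          (fun (L : Fin d → Option (Fin a) → ℝ × Bool × ℝ) s k => redraw b (L s k))
          (Measure.pi fun _ => Measure.pi fun _ => entryMeasure v) (layerLaw a d v b) :=
      measurePreserving_pi _ _ fun _ => hneuron a v b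
    unfold drawMeasure paramsLaw
    exact measurePreserving_pi
      (fun ℓ : Fin n => Measure.pi fun _ : Fin (m (ℓ + 1)) => Measure.pi fun _ : Option (Fin (m ℓ)) =>
        entryMeasure (variance n m (ℓ + 1)))
      (fun ℓ : Fin n => layerLaw (m ℓ) (m (ℓ + 1)) (variance n m (ℓ + 1)) (r ℓ))
      fun ℓ => hlayer (m ℓ) (m (ℓ + 1)) (variance n m (ℓ + 1)) (r ℓ)
  exact ⟨h.measurable, h.map_eq⟩

theorem variance_ne_zero (hm : ∀ ℓ ≤ n, 1 ≤ m ℓ) (ℓ : Fin n) : variance n m (ℓ + 1) ≠ 0 := by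
  have h : m (ℓ + 1) ≠ 0 := Nat.one_le_iff_ne_zero.1 (hm _ ℓ.2)
  unfold variance
  split_ifs
  · positivity
  · simp only [ne_eq, div_eq_zero_iff, not_or]
    refine ⟨two_ne_zero, mul_ne_zero (by exact_mod_cast h) (by positivity)⟩

theorem lpsMeasure_real_eq_sum (κ : Measure (Fin n → Bool)) [IsProbabilityMeasure κ]
    {B : Set (Params n m)} (hB : MeasurableSet B) :
    (lpsMeasure n m κ).real {p | reinit p.1 p.2 ∈ B} =
      ∑ r, κ.real {r} * (paramsLaw (variance n m) r).real B := by
  have hS : {p : (Fin n → Bool) × Draws n m | reinit p.1 p.2 ∈ B} =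
      ⋃ r, {r} ×ˢ {ω | reinit r ω ∈ B} := by
    ext ⟨r, ω⟩; simp
  have hmeas : MeasurableSet {p : (Fin n → Bool) × Draws n m | reinit p.1 p.2 ∈ B} := by
    rw [hS]
    exact MeasurableSet.iUnion fun r => (measurableSet_singleton r).prod ((map_reinit r).1 hB)
  rw [measureReal_def, lpsMeasure, Measure.prod_apply hmeas, lintegral_fintype,
    ENNReal.toReal_sum fun c _ => ENNReal.mul_ne_top (measure_ne_top _ _) (measure_ne_top _ _)]
  refine Finset.sum_congr rfl fun r _ => ?_
  rw [ENNReal.toReal_mul, mul_comm, ← (map_reinit r).2, measureReal_def, measureReal_def,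
    Measure.map_apply (map_reinit r).1 hB]
  rfl

end Experiment
end LPS

theorem theorem4p1 :
    ∃ δ : ℝ, 0 < δ ∧ δ ≤ 1 / 2 ∧
      ∀ (n : ℕ) (_ : 1 ≤ n) (m : ℕ → ℕ) (_ : ∀ ℓ ≤ n, 1 ≤ m ℓ) (c : ℝ) (_ : 0 < c)
        (κ : Measure (Fin n → Bool)) [IsProbabilityMeasure κ]
        (_ : ∀ ℓ : Fin n, κ.real {r | r ℓ = true} = LPS.layerProb n (ℓ + 1)),
        (LPS.lpsMeasure n m κ).real
            {p | LPS.BornDead (LPS.reinit p.1 p.2) (LPS.cube (m 0) c)} ≤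
          1 - ∏ ℓ ∈ Finset.Icc 1 (n - 1),
            (1 - (2 : ℝ)⁻¹ ^ m ℓ *
              ((1 - LPS.layerProb n ℓ) + LPS.layerProb n ℓ * (1 - δ / 2) ^ m ℓ)) := by
  -- The single-neuron rate 3/8 would correspond to `δ = 1/2`; half of it is spent on the dependence
  -- between layers.
  refine ⟨1 / 4, by norm_num, by norm_num, ?_⟩
  intro n hn m hm c hc κ _ hκ
  have hδ : (1 - 1 / 4 / 2 : ℝ) = 7 / 8 := by norm_num
  obtain ⟨n, rfl⟩ := Nat.exists_eq_add_of_le' hn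
  have h0 : (0 : Fin (m 0) → ℝ) ∈ LPS.cube (m 0) c := fun i => ⟨by simp [hc.le], by simp [hc.le]⟩
  have hD : ∃ x ∈ LPS.cube (m 0) c, x ≠ 0 :=
    ⟨fun _ => c, fun i => ⟨by linarith, le_rfl⟩,
      fun h => hc.ne' (congrFun h ⟨0, hm 0 (Nat.zero_le _)⟩)⟩
  have hdead := LPS.lpsMeasure_real_eq_sum κ (LPS.measurableSet_bornDead (m := m) hn h0)
  have hw1 : ∑ r, κ.real {r} = 1 := by
    rw [sum_measureReal_singleton, Finset.coe_univ, probReal_univ]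
  have hχ : ∀ i : Fin n, ∑ r, κ.real {r} * (if r i.castSucc = true then (1 : ℝ) else 0) =
      LPS.layerProb (n + 1) (i + 1) := by
    intro i
    rw [← Fin.val_castSucc i, ← hκ i.castSucc]
    simp only [mul_ite, mul_one, mul_zero]
    rw [← Finset.sum_filter, sum_measureReal_singleton]
    congr 1
    ext r; simp
  have havg := LPS.prod_mixture_le_average (fun _ => measureReal_nonneg) hw1
    (fun r (i : Fin n) => r i.castSucc) hχ (LPS.sum_layerProb_le_one n)
    (M := fun i => m (i + 1)) fun i => hm _ (by omega)
  -- After the substitution `n + 1` for the depth, the `n` hidden layers `ℓ = 1, …, n` stand at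
  -- indices `ℓ - 1`.
  have hprod : ∏ ℓ ∈ Finset.Icc 1 (n + 1 - 1), (1 - (2 : ℝ)⁻¹ ^ m ℓ *
        ((1 - LPS.layerProb (n + 1) ℓ) + LPS.layerProb (n + 1) ℓ * (7 / 8) ^ m ℓ)) =
      ∏ i : Fin n, (1 - (2 : ℝ)⁻¹ ^ m (i + 1) * ((1 - LPS.layerProb (n + 1) (i + 1)) +
        LPS.layerProb (n + 1) (i + 1) * (7 / 8) ^ m (i + 1))) := by
    rw [Fin.prod_univ_eq_prod_range (fun i => (1 - (2 : ℝ)⁻¹ ^ m (i + 1) *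
      ((1 - LPS.layerProb (n + 1) (i + 1)) + LPS.layerProb (n + 1) (i + 1) *
        (7 / 8) ^ m (i + 1)))) n, Finset.range_eq_Ico, Finset.prod_Ico_add' (fun i =>
      (1 - (2 : ℝ)⁻¹ ^ m i * ((1 - LPS.layerProb (n + 1) i) + LPS.layerProb (n + 1) i *
        (7 / 8) ^ m i))) 0 n 1]
    rfl
  rw [hδ, hprod]
  refine hdead.le.trans ?_
  calc ∑ r, κ.real {r} * (LPS.paramsLaw (LPS.variance (n + 1) m) r).real
          {θ : LPS.Params (n + 1) m | LPS.BornDead θ (LPS.cube (m 0) c)}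
      ≤ ∑ r, κ.real {r} * (1 - ∏ i : Fin n, (1 - LPS.layerInactiveProb m r i.castSucc)) :=
        Finset.sum_le_sum fun r _ => mul_le_mul_of_nonneg_left
          (LPS.bornDead_real_le (LPS.variance_ne_zero hm) (hm _ le_rfl) h0 hD) measureReal_nonneg
    _ = 1 - ∑ r, κ.real {r} * ∏ i : Fin n, (1 - LPS.layerInactiveProb m r i.castSucc) := by
        simp only [mul_sub, mul_one, Finset.sum_sub_distrib, hw1]
    _ ≤ _ := sub_le_sub_left havg 1
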